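/- Let $\mathcal L_{PA}$ be the language with $0$, $S$, $+$, $\times$. Fix a standard arithmetisation of the syntax of $\mathcal L_{PA}$-formulas built from equations with $\neg,\vee,\exists$ (so that $\varphi\wedge\psi$ abbreviates $\neg(\neg\varphi\vee\neg\psi)$ and $\varphi\to\psi$ abbreviates $\neg\varphi\vee\psi$). A model of $\mathrm{CT}^-$ is a pair $(M,T)$ with $M\models\mathrm{PA}$ and $T\subseteq M$ such that, in the sense of $M$: 1. for all closed terms $s,t$: $T(s=t)$ iff $s$ and $t$ have the same value; 2. for all sentences $\varphi$: $T(\neg\varphi)$ iff not $T(\varphi)$; 3. for all sentences $\varphi,\psi$: $T(\varphi\vee\psi)$ iff $T(\varphi)$ or $T(\psi)$; 4. for all variables $v$ and formulas $\varphi$ with at most one free variable: $T(\exists v\,\varphi)$ iff $T(\varphi[\underline{x}/v])$ for some $x\in M$, where $\underline{x}$ is the numeral of $x$; 5. for all formulas $\varphi$ and all coded sequences $\bar s,\bar t$ of closed terms, of the same length, that are substituted for the free variables of $\varphi$: if $\bar s$ and $\bar t$ have termwise equal values, then $T(\varphi(\bar s))$ iff $T(\varphi(\bar t))$. No induction is assumed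 for formulas that contain $T$. Let $(M,T)\models\mathrm{CT}^-$, let $c\in M$, and let $(\alpha_i)_{i\le c}$, $(\beta_i)_{i\le c}$ be sequences, coded in $M$, of sentences in the sense of $M$. The disjunction with stopping condition $\bigvee_{i=a}^{c,\alpha}\beta_i$ is defined inside $M$, for $a\le c$, by backward recursion on $a$: $$\bigvee_{i=c}^{c,\alpha}\beta_i=(\alpha_c\wedge\beta_c),\qquad \bigvee_{i=a}^{c,\alpha}\beta_i=(\alpha_a\to\beta_a)\wedge\Big[(\alpha_a\wedge\beta_a)\vee\big(\neg\alpha_a\wedge\bigvee_{i=a+1}^{c,\alpha}\beta_i\big)\Big]\quad(a<c);$$ that is, it is the $a$-th element of a sequence coded in $M$ that satisfies these equations. **Theorem.** For every $a\le c$ the element $\bigvee_{i=a}^{c,\alpha}\beta_i$ of $M$ exists and is unique. Suppose that there is a least $k_0\le c$ such that $T(\alpha_{k_0})$ holds in $(M,T)$, and that this $k_0$ is standard. Then $$(M,T)\models\; T\Big(\bigvee_{i=0}^{c,\alpha}\beta_i\Big)\equiv T(\beta_{k_0}).$$ -/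

import Mathlib

open FirstOrder FirstOrder.Language

universe u

/-! ### The language and the axioms of Peano arithmetic -/

/-- Function symbols `0`, `S`, `+`, `×`. -/
inductive LPAFunc : ℕ → Type
  | zero : LPAFunc 0
  | succ : LPAFunc 1
  | add : LPAFunc 2
  | mul : LPAFunc 2

/-- The language of Peano arithmetic (equality is the only relation symbol). -/
def LPA : FirstOrder.Language.{0, 0} := ⟨LPAFunc, fun _ => Empty⟩

namespace PA

abbrev fZero : LPA.Functions 0 := LPAFunc.zero

abbrev fSucc : LPA.Functions 1 := LPAFunc.succ

abbrev fAdd : LPA.Functions 2 := LPAFunc.add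

abbrev fMul : LPA.Functions 2 := LPAFunc.mul

def tZero {γ : Type} : LPA.Term γ := Term.func fZero ![]

def tSucc {γ : Type} (t : LPA.Term γ) : LPA.Term γ := Term.func fSucc ![t]

def tAdd {γ : Type} (t s : LPA.Term γ) : LPA.Term γ := Term.func fAdd ![t, s]

def tMul {γ : Type} (t s : LPA.Term γ) : LPA.Term γ := Term.func fMul ![t, s]

def axSuccNeZero : LPA.Sentence :=
  ∀' ∼((tSucc &0).bdEqual tZero)

def axSuccInj : LPA.Sentence :=
  ∀' ∀' (((tSucc &0).bdEqual (tSucc &1)) ⟹ ((&0 : LPA.Term (Empty ⊕ Fin 2)).bdEqual &1))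

def axAddZero : LPA.Sentence :=
  ∀' ((tAdd &0 tZero).bdEqual &0)

def axAddSucc : LPA.Sentence :=
  ∀' ∀' ((tAdd &0 (tSucc &1)).bdEqual (tSucc (tAdd &0 &1)))

def axMulZero : LPA.Sentence :=
  ∀' ((tMul &0 tZero).bdEqual tZero)

def axMulSucc : LPA.Sentence :=
  ∀' ∀' ((tMul &0 (tSucc &1)).bdEqual (tAdd (tMul &0 &1) &0))

/-- `φ(p, 0) ∧ ∀ x (φ(p, x) → φ(p, S x)) → ∀ x φ(p, x)`, with parameters `p = (p_0, …, p_{n-1})`. -/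
noncomputable def inductionFormula {n : ℕ} (φ : LPA.Formula (Fin n ⊕ Unit)) :
    LPA.Formula (Fin n) :=
  let base : LPA.Formula (Fin n) :=
    BoundedFormula.subst φ (Sum.elim (fun i => Term.var i) (fun _ => tZero))
  let next : LPA.Formula (Fin n ⊕ Unit) :=
    BoundedFormula.subst φ
      (Sum.elim (fun i => Term.var (Sum.inl i)) (fun j => tSucc (Term.var (Sum.inr j))))
  (base ⊓ Formula.iAlls Unit (φ.imp next)).imp (Formula.iAlls Unit φ)

/-- The universal closure of the induction axiom for `φ`. -/
noncomputable def axInduction {n : ℕ} (φ : LPA.Formula (Fin n ⊕ Unit)) : LPA.Sentence :=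
  Formula.iAlls (Fin n) ((inductionFormula φ).relabel (Sum.inr : Fin n → Empty ⊕ Fin n))

end PA

/-- Peano arithmetic. -/
def PeanoArithmetic : LPA.Theory :=
  {PA.axSuccNeZero, PA.axSuccInj, PA.axAddZero, PA.axAddSucc, PA.axMulZero, PA.axMulSucc} ∪
    {σ | ∃ (n : ℕ) (φ : LPA.Formula (Fin n ⊕ Unit)), σ = PA.axInduction φ}

/-! ### Arithmetic inside a structure

All predicates below are spelled out with quantifiers over elements of `M` only, so each of them
is the interpretation in `M` of an arithmetical formula. -/

namespace PA

variable {M : Type u} [LPA.Structure M]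

def zero : M := Structure.funMap fZero ![]

def succ (x : M) : M := Structure.funMap fSucc ![x]

def add (x y : M) : M := Structure.funMap fAdd ![x, y]

def mul (x y : M) : M := Structure.funMap fMul ![x, y]

def le (x y : M) : Prop := ∃ z, add x z = y

def lt (x y : M) : Prop := ∃ z, add x (succ z) = y

/-- The element `S … S 0` of `M`, with `n` occurrences of `S`. -/
def std : ℕ → M
  | 0 => zero
  | n + 1 => succ (std n)

def IsStandard (x : M) : Prop := ∃ n : ℕ, std n = x

/-- The injective pairing `⟨x, y⟩ = (x + y)² + x`. -/
def pair (x y : M) : M := add (mul (add x y) (add x y)) x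

/-- `Elem s i z`: the `i`-th element of the sequence coded by `s` is `z`. This is Gödel's
`β`-function: for `s = ⟨a, b⟩`, `z` is the remainder of `a` modulo `1 + (i + 1) b`. -/
def Elem (s i z : M) : Prop :=
  ∃ a b q, s = pair a b ∧ a = add (mul q (succ (mul (succ i) b))) z ∧
    lt z (succ (mul (succ i) b))

/-- The sequence `(f i)_{i ≤ c}` is coded in `M`. Only the values `f i` with `i ≤ c` matter. -/
def CodedSeq (c : M) (f : M → M) : Prop := ∃ s, ∀ i, le i c → Elem s i (f i)

/-- `x` is the last term of a coded sequence `s_0, …, s_l` of `M` each term of which is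
obtained, by the rules `step`, from earlier terms of the sequence. -/
def Gen (step : (M → Prop) → M → Prop) (x : M) : Prop :=
  ∃ s l, Elem s l x ∧
    ∀ i, le i l → ∃ y, Elem s i y ∧ step (fun z => ∃ j, lt j i ∧ Elem s j z) y

/-! ### Arithmetised syntax: codes of terms and formulas -/

def cZero : M := pair (std 1) zero

/-- The variable with index `v`. -/
def cVar (v : M) : M := pair (std 2) v

def cSucc (t : M) : M := pair (std 3) t

def cAdd (t u : M) : M := pair (std 4) (pair t u)

def cMul (t u : M) : M := pair (std 5) (pair t u)

def cEq (t u : M) : M := pair (std 6) (pair t u)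

def cNeg (φ : M) : M := pair (std 7) φ

def cOr (φ ψ : M) : M := pair (std 8) (pair φ ψ)

/-- `∃ v φ`, where `v` is the index of the quantified variable. -/
def cEx (v φ : M) : M := pair (std 9) (pair v φ)

def cAnd (φ ψ : M) : M := cNeg (cOr (cNeg φ) (cNeg ψ))

def cImp (φ ψ : M) : M := cOr (cNeg φ) ψ

/-- `t` is (the code in `M` of) a term. -/
def IsTerm (t : M) : Prop :=
  Gen (fun P y => y = cZero ∨ (∃ v, y = cVar v) ∨ (∃ t, P t ∧ y = cSucc t) ∨
    (∃ t u, P t ∧ P u ∧ y = cAdd t u) ∨ (∃ t u, P t ∧ P u ∧ y = cMul t u)) t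

/-- `t` is a closed term. -/
def IsClTerm (t : M) : Prop :=
  Gen (fun P y => y = cZero ∨ (∃ t, P t ∧ y = cSucc t) ∨
    (∃ t u, P t ∧ P u ∧ y = cAdd t u) ∨ (∃ t u, P t ∧ P u ∧ y = cMul t u)) t

/-- `φ` is a formula. -/
def IsForm (φ : M) : Prop :=
  Gen (fun P y => (∃ t u, IsTerm t ∧ IsTerm u ∧ y = cEq t u) ∨ (∃ φ, P φ ∧ y = cNeg φ) ∨
    (∃ φ ψ, P φ ∧ P ψ ∧ y = cOr φ ψ) ∨ (∃ v φ, P φ ∧ y = cEx v φ)) φ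

/-- The variable with index `v` occurs in the term `t`. -/
def OccursIn (v t : M) : Prop :=
  Gen (fun P y => y = cVar v ∨ (∃ t, P t ∧ y = cSucc t) ∨
    (∃ t u, (P t ∨ P u) ∧ y = cAdd t u) ∨ (∃ t u, (P t ∨ P u) ∧ y = cMul t u)) t

/-- The variable with index `v` occurs free in the formula `φ`. -/
def FreeIn (v φ : M) : Prop :=
  Gen (fun P y => (∃ t u, (OccursIn v t ∨ OccursIn v u) ∧ y = cEq t u) ∨
    (∃ φ, P φ ∧ y = cNeg φ) ∨ (∃ φ ψ, (P φ ∨ P ψ) ∧ y = cOr φ ψ) ∨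
    (∃ w φ, w ≠ v ∧ P φ ∧ y = cEx w φ)) φ

/-- `φ` is a sentence. -/
def IsSent (φ : M) : Prop := IsForm φ ∧ ∀ v, ¬ FreeIn v φ

/-- `φ` is a formula with at most one free variable. -/
def IsForm1 (φ : M) : Prop := IsForm φ ∧ ∀ v w, FreeIn v φ → FreeIn w φ → v = w

/-- `t` is the numeral `S … S 0` denoting `x`. -/
def IsNumeral (x t : M) : Prop :=
  Gen (fun P y => y = pair zero cZero ∨ (∃ x t, P (pair x t) ∧ y = pair (succ x) (cSucc t)))
    (pair x t)

/-- `x` is the value of the closed term `t`. -/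
def HasVal (t x : M) : Prop :=
  Gen (fun P y => y = pair cZero zero ∨ (∃ t x, P (pair t x) ∧ y = pair (cSucc t) (succ x)) ∨
    (∃ t x u z, P (pair t x) ∧ P (pair u z) ∧ y = pair (cAdd t u) (add x z)) ∨
    (∃ t x u z, P (pair t x) ∧ P (pair u z) ∧ y = pair (cMul t u) (mul x z))) (pair t x)

def SameVal (s t : M) : Prop := ∃ x, HasVal s x ∧ HasVal t x

/-- `u'` is the result of substituting the term `t` for the variable `v` in the term `u`. -/
def TermSubst (v t u u' : M) : Prop :=
  Gen (fun P y => y = pair cZero cZero ∨ y = pair (cVar v) t ∨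
    (∃ w, w ≠ v ∧ y = pair (cVar w) (cVar w)) ∨
    (∃ a a', P (pair a a') ∧ y = pair (cSucc a) (cSucc a')) ∨
    (∃ a a' b b', P (pair a a') ∧ P (pair b b') ∧ y = pair (cAdd a b) (cAdd a' b')) ∨
    (∃ a a' b b', P (pair a a') ∧ P (pair b b') ∧ y = pair (cMul a b) (cMul a' b'))) (pair u u')

/-- `φ'` is the result of substituting the closed term `t` for the free occurrences of the
variable `v` in the formula `φ`. -/
def FormSubst (v t φ φ' : M) : Prop :=
  Gen (fun P y =>
    (∃ a a' b b', TermSubst v t a a' ∧ TermSubst v t b b' ∧ y = pair (cEq a b) (cEq a' b')) ∨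
    (∃ φ φ', P (pair φ φ') ∧ y = pair (cNeg φ) (cNeg φ')) ∨
    (∃ φ φ' ψ ψ', P (pair φ φ') ∧ P (pair ψ ψ') ∧ y = pair (cOr φ ψ) (cOr φ' ψ')) ∨
    (∃ w φ φ', w ≠ v ∧ P (pair φ φ') ∧ y = pair (cEx w φ) (cEx w φ')) ∨
    (∃ φ, IsForm φ ∧ y = pair (cEx v φ) (cEx v φ))) (pair φ φ')

/-- `ψ` is the result of substituting the closed terms `t_0, …, t_{l-1}` (where `t_i` is the `i`-th
element of the sequence `t`) for the variables with indices `0, …, l - 1` in `φ`. The terms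
being closed, the simultaneous substitution may be carried out one variable at a time. -/
def SeqSubst (l t φ ψ : M) : Prop :=
  ∃ r, Elem r zero φ ∧ Elem r l ψ ∧
    ∀ i, lt i l → ∃ x y u, Elem r i x ∧ Elem r (succ i) y ∧ Elem t i u ∧ FormSubst i u x y

/-- `(M, T)` is a model of `CT⁻`, the compositional theory of truth over Peano arithmetic. -/
structure IsCTMinus (M : Type u) [LPA.Structure M] (T : Set M) : Prop where
  pa : M ⊨ PeanoArithmetic
  eq : ∀ s t : M, IsClTerm s → IsClTerm t → (cEq s t ∈ T ↔ SameVal s t)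
  neg : ∀ φ : M, IsSent φ → (cNeg φ ∈ T ↔ φ ∉ T)
  or : ∀ φ ψ : M, IsSent φ → IsSent ψ → (cOr φ ψ ∈ T ↔ φ ∈ T ∨ ψ ∈ T)
  ex : ∀ v φ : M, IsForm1 φ →
    (cEx v φ ∈ T ↔ ∃ x t ψ, IsNumeral x t ∧ FormSubst v t φ ψ ∧ ψ ∈ T)
  regularity : ∀ l s t φ φs φt : M,
    (∀ i, lt i l → ∃ a b, Elem s i a ∧ Elem t i b ∧ IsClTerm a ∧ IsClTerm b ∧ SameVal a b) →
    IsForm φ → (∀ v, FreeIn v φ → lt v l) → SeqSubst l s φ φs → SeqSubst l t φ φt →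
    (φs ∈ T ↔ φt ∈ T)

/-- `δ` is the disjunction with stopping condition `⋁_{i=a}^{c,α} β_i`: it is the `a`-th element
of a coded sequence `(d i)_{i ≤ c}` of `M` that satisfies the backward recursion
`d c = α_c ∧ β_c` and, for `i < c`,
`d i = (α_i → β_i) ∧ ((α_i ∧ β_i) ∨ (¬ α_i ∧ d (i + 1)))`. -/
def IsStoppingDisj (c : M) (α β : M → M) (a δ : M) : Prop :=
  ∃ d : M → M, CodedSeq c d ∧ d c = cAnd (α c) (β c) ∧
    (∀ i, lt i c → d i = cAnd (cImp (α i) (β i))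
      (cOr (cAnd (α i) (β i)) (cAnd (cNeg (α i)) (d (succ i))))) ∧
    d a = δ

end PA

/-! The truth-theoretic part is short. If `α i` is false, the formula at index `i` has the truth
value of the formula at `i + 1`; if `α i` is true, it has that of `β i`
(`IsCTMinus.stoppingStep_iff`). So the truth value at index `0` is carried up to `k₀`, where it
becomes that of `β k₀`. This is an induction on a statement about `T`, which `M` need not satisfy;
since `k₀` is standard, it is carried out as an ordinary induction on natural numbers.

The clauses for the connectives apply to sentences only, so every term of the recursion up to the
possibly nonstandard `c` must be a sentence in the sense of `M`. That fact, and existence and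
uniqueness of the recursion, are arithmetical, so induction inside `M` proves them. `DefPred` and
`TermFun` let instance search find the formulas that `PAModel.induction` needs. As `α`, `β` and the
solution are arbitrary functions outside `[0, c]`, the induction predicates mention their codes
instead.

Existence extends a coded sequence backwards one entry at a time (`exists_stopping_code`). Each new
code comes from `exists_code`, Gödel's β-lemma, proved in `M` by the Chinese remainder theorem. The
same lemma concatenates derivation sequences (`Gen.intro`), which makes sentences closed under the
connectives. -/

namespace PA

/-! ### Definable predicates and the induction principle -/

section Definability

variable {M : Type u} [LPA.Structure M] {n : ℕ}

/-- `f` is given by a term with parameters from `M`. -/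
class TermFun (f : (Fin n → M) → M) : Prop where
  out : ∃ t : LPA.Term (M ⊕ Fin n), ∀ v, t.realize (Sum.elim id v) = f v

/-- `P` is given by a formula with parameters from `M`. -/
class DefPred (P : (Fin n → M) → Prop) : Prop where
  out : ∃ φ : LPA.Formula (M ⊕ Fin n), ∀ v, φ.Realize (Sum.elim id v) ↔ P v

instance TermFun.const (a : M) : TermFun (fun _ : Fin n → M => a) :=
  ⟨Term.var (Sum.inl a), fun _ => rfl⟩

instance TermFun.var (i : Fin n) : TermFun (fun v : Fin n → M => v i) :=
  ⟨Term.var (Sum.inr i), fun _ => rfl⟩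

instance TermFun.succ (f : (Fin n → M) → M) [hf : TermFun f] :
    TermFun (fun v => succ (f v)) := by
  obtain ⟨t, ht⟩ := hf
  refine ⟨Term.func fSucc ![t], fun v => ?_⟩
  rw [Term.realize_func, PA.succ, ← ht]
  congr 1; funext i; fin_cases i; rfl

instance TermFun.add (f g : (Fin n → M) → M) [hf : TermFun f] [hg : TermFun g] :
    TermFun (fun v => add (f v) (g v)) := by
  obtain ⟨t, ht⟩ := hf
  obtain ⟨s, hs⟩ := hg
  refine ⟨Term.func fAdd ![t, s], fun v => ?_⟩
  rw [Term.realize_func, PA.add, ← ht, ← hs]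
  congr 1; funext i; fin_cases i <;> rfl

instance TermFun.mul (f g : (Fin n → M) → M) [hf : TermFun f] [hg : TermFun g] :
    TermFun (fun v => mul (f v) (g v)) := by
  obtain ⟨t, ht⟩ := hf
  obtain ⟨s, hs⟩ := hg
  refine ⟨Term.func fMul ![t, s], fun v => ?_⟩
  rw [Term.realize_func, PA.mul, ← ht, ← hs]
  congr 1; funext i; fin_cases i <;> rfl

instance TermFun.pair (f g : (Fin n → M) → M) [hf : TermFun f] [hg : TermFun g] :
    TermFun (fun v => pair (f v) (g v)) := by
  unfold PA.pair; infer_instance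

instance TermFun.cVar (f : (Fin n → M) → M) [TermFun f] : TermFun (fun v => cVar (f v)) := by
  unfold PA.cVar; infer_instance

instance TermFun.cSucc (f : (Fin n → M) → M) [TermFun f] : TermFun (fun v => cSucc (f v)) := by
  unfold PA.cSucc; infer_instance

instance TermFun.cNeg (f : (Fin n → M) → M) [TermFun f] : TermFun (fun v => cNeg (f v)) := by
  unfold PA.cNeg; infer_instance

instance TermFun.cAdd (f g : (Fin n → M) → M) [TermFun f] [TermFun g] :
    TermFun (fun v => cAdd (f v) (g v)) := by
  unfold PA.cAdd; infer_instance

instance TermFun.cMul (f g : (Fin n → M) → M) [TermFun f] [TermFun g] :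
    TermFun (fun v => cMul (f v) (g v)) := by
  unfold PA.cMul; infer_instance

instance TermFun.cEq (f g : (Fin n → M) → M) [TermFun f] [TermFun g] :
    TermFun (fun v => cEq (f v) (g v)) := by
  unfold PA.cEq; infer_instance

instance TermFun.cOr (f g : (Fin n → M) → M) [TermFun f] [TermFun g] :
    TermFun (fun v => cOr (f v) (g v)) := by
  unfold PA.cOr; infer_instance

instance TermFun.cEx (f g : (Fin n → M) → M) [TermFun f] [TermFun g] :
    TermFun (fun v => cEx (f v) (g v)) := by
  unfold PA.cEx; infer_instance

instance TermFun.cAnd (f g : (Fin n → M) → M) [TermFun f] [TermFun g] :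
    TermFun (fun v => cAnd (f v) (g v)) := by
  unfold PA.cAnd; infer_instance

instance TermFun.cImp (f g : (Fin n → M) → M) [TermFun f] [TermFun g] :
    TermFun (fun v => cImp (f v) (g v)) := by
  unfold PA.cImp; infer_instance

instance DefPred.eq (f g : (Fin n → M) → M) [hf : TermFun f] [hg : TermFun g] :
    DefPred (fun v => f v = g v) := by
  obtain ⟨t, ht⟩ := hf
  obtain ⟨s, hs⟩ := hg
  exact ⟨t.equal s, fun v => by rw [Formula.realize_equal, ht, hs]⟩

instance DefPred.not (P : (Fin n → M) → Prop) [hP : DefPred P] : DefPred (fun v => ¬ P v) := by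
  obtain ⟨φ, hφ⟩ := hP
  exact ⟨φ.not, fun v => by rw [Formula.realize_not, hφ]⟩

instance DefPred.imp (P Q : (Fin n → M) → Prop) [hP : DefPred P] [hQ : DefPred Q] :
    DefPred (fun v => P v → Q v) := by
  obtain ⟨φ, hφ⟩ := hP
  obtain ⟨ψ, hψ⟩ := hQ
  exact ⟨φ.imp ψ, fun v => by rw [Formula.realize_imp, hφ, hψ]⟩

instance DefPred.ne (f g : (Fin n → M) → M) [TermFun f] [TermFun g] :
    DefPred (fun v => f v ≠ g v) :=
  DefPred.not (fun v => f v = g v)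

instance DefPred.and (P Q : (Fin n → M) → Prop) [hP : DefPred P] [hQ : DefPred Q] :
    DefPred (fun v => P v ∧ Q v) := by
  obtain ⟨φ, hφ⟩ := hP
  obtain ⟨ψ, hψ⟩ := hQ
  exact ⟨φ ⊓ ψ, fun v => by rw [Formula.realize_inf, hφ, hψ]⟩

instance DefPred.or (P Q : (Fin n → M) → Prop) [hP : DefPred P] [hQ : DefPred Q] :
    DefPred (fun v => P v ∨ Q v) := by
  obtain ⟨φ, hφ⟩ := hP
  obtain ⟨ψ, hψ⟩ := hQ
  exact ⟨φ ⊔ ψ, fun v => by rw [Formula.realize_sup, hφ, hψ]⟩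

/-- The quantified element becomes the last coordinate of a longer assignment, so instance search
can peel off quantifiers one at a time. -/
instance DefPred.all (P : (Fin n → M) → M → Prop)
    [hP : DefPred (fun w : Fin (n + 1) → M => P (fun i => w i.castSucc) (w (Fin.last n)))] :
    DefPred (fun v => ∀ x, P v x) := by
  obtain ⟨φ, hφ⟩ := hP
  let g : M ⊕ Fin (n + 1) → (M ⊕ Fin n) ⊕ Unit :=
    Sum.elim (fun a => Sum.inl (Sum.inl a))
      (Fin.lastCases (Sum.inr ()) (fun i => Sum.inl (Sum.inr i)))
  refine ⟨Formula.iAlls Unit (φ.relabel g), fun v => ?_⟩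
  rw [Formula.realize_iAlls]
  have key : ∀ x : Unit → M, Sum.elim (Sum.elim id v) x ∘ g
      = Sum.elim id (Fin.snoc v (x ()) : Fin (n + 1) → M) := by
    intro x
    funext a
    rcases a with a | a
    · rfl
    · refine Fin.lastCases ?_ (fun i => ?_) a <;> simp [g]
  have key2 : ∀ x : Unit → M, (φ.relabel g).Realize (Sum.elim (Sum.elim id v) x) ↔ P v (x ()) := by
    intro x
    rw [Formula.realize_relabel, key, hφ]
    simp
  exact ⟨fun h x => (key2 fun _ => x).1 (h _), fun h x => (key2 x).2 (h _)⟩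

instance DefPred.ex (P : (Fin n → M) → M → Prop)
    [DefPred (fun w : Fin (n + 1) → M => P (fun i => w i.castSucc) (w (Fin.last n)))] :
    DefPred (fun v => ∃ x, P v x) := by
  have : DefPred (fun v => ¬ ∀ x, ¬ P v x) := inferInstance
  simpa only [not_forall, not_not] using this

/-- Substitution of terms for variables: a predicate shown definable once in its bare variables may
then be used with arbitrary term arguments. -/
theorem DefPred.comp {k : ℕ} {P : (Fin k → M) → Prop} (hP : DefPred P)
    (f : Fin k → (Fin n → M) → M) (hf : ∀ j, TermFun (f j)) :
    DefPred (fun v => P (fun j => f j v)) := by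
  obtain ⟨φ, hφ⟩ := hP
  choose t ht using fun j => (hf j).out
  refine ⟨BoundedFormula.subst φ (Sum.elim (fun a => Term.var (Sum.inl a)) t), fun v => ?_⟩
  rw [Formula.Realize, BoundedFormula.realize_subst, ← hφ, Formula.Realize]
  refine iff_of_eq (congrArg (fun w => BoundedFormula.Realize φ w _) ?_)
  funext a
  rcases a with a | j
  · rfl
  · exact ht j v

theorem DefPred.comp1 {P : M → Prop} (hP : DefPred (fun v : Fin 1 → M => P (v 0)))
    (f : (Fin n → M) → M) [hf : TermFun f] : DefPred (fun v => P (f v)) :=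
  hP.comp ![f] (fun j => by fin_cases j; exact hf)

theorem DefPred.comp2 {P : M → M → Prop} (hP : DefPred (fun v : Fin 2 → M => P (v 0) (v 1)))
    (f g : (Fin n → M) → M) [hf : TermFun f] [hg : TermFun g] :
    DefPred (fun v => P (f v) (g v)) :=
  hP.comp ![f, g] (fun j => by fin_cases j; exacts [hf, hg])

theorem DefPred.comp3 {P : M → M → M → Prop}
    (hP : DefPred (fun v : Fin 3 → M => P (v 0) (v 1) (v 2)))
    (f g h : (Fin n → M) → M) [hf : TermFun f] [hg : TermFun g] [hh : TermFun h] :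
    DefPred (fun v => P (f v) (g v) (h v)) :=
  hP.comp ![f, g, h] (fun j => by fin_cases j; exacts [hf, hg, hh])

instance DefPred.le (f g : (Fin n → M) → M) [TermFun f] [TermFun g] :
    DefPred (fun v => le (f v) (g v)) :=
  DefPred.comp2 (P := PA.le) (by unfold PA.le; infer_instance) f g

instance DefPred.lt (f g : (Fin n → M) → M) [TermFun f] [TermFun g] :
    DefPred (fun v => lt (f v) (g v)) :=
  DefPred.comp2 (P := PA.lt) (by unfold PA.lt; infer_instance) f g

instance DefPred.elem (f g h : (Fin n → M) → M) [TermFun f] [TermFun g] [TermFun h] :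
    DefPred (fun v => Elem (f v) (g v) (h v)) :=
  DefPred.comp3 (P := PA.Elem) (by unfold PA.Elem; infer_instance) f g h

/-- With a concrete rule in place of `step`, unfolding `Gen` leaves only quantifiers over elements
of `M`. -/
instance DefPred.isTerm (f : (Fin n → M) → M) [TermFun f] : DefPred (fun v => IsTerm (f v)) :=
  DefPred.comp1 (P := PA.IsTerm) (by unfold PA.IsTerm Gen; infer_instance) f

instance DefPred.isForm (f : (Fin n → M) → M) [TermFun f] : DefPred (fun v => IsForm (f v)) :=
  DefPred.comp1 (P := PA.IsForm) (by unfold PA.IsForm Gen; infer_instance) f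

instance DefPred.occursIn (f g : (Fin n → M) → M) [TermFun f] [TermFun g] :
    DefPred (fun v => OccursIn (f v) (g v)) :=
  DefPred.comp2 (P := PA.OccursIn) (by unfold PA.OccursIn Gen; infer_instance) f g

instance DefPred.freeIn (f g : (Fin n → M) → M) [TermFun f] [TermFun g] :
    DefPred (fun v => FreeIn (f v) (g v)) :=
  DefPred.comp2 (P := PA.FreeIn) (by unfold PA.FreeIn Gen; infer_instance) f g

instance DefPred.isSent (f : (Fin n → M) → M) [TermFun f] : DefPred (fun v => IsSent (f v)) :=
  DefPred.comp1 (P := PA.IsSent) (by unfold PA.IsSent; infer_instance) f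

end Definability

/-- `M` is a model of Peano arithmetic. -/
class PAModel (M : Type u) [LPA.Structure M] : Prop where
  models : M ⊨ PeanoArithmetic

theorem PAModel.induction {M : Type u} [LPA.Structure M] [hM : PAModel M] {P : M → Prop}
    (hP : DefPred (fun v : Fin 1 → M => P (v 0)))
    (h0 : P zero) (hs : ∀ x, P x → P (succ x)) (x : M) : P x := by
  classical
  obtain ⟨φ, hφ⟩ := hP
  let e := Fintype.equivFin φ.freeVarFinset
  -- The scheme allows a finite list of parameters, so only those occurring in `φ` are listed. The
  -- slot of the induction variable, if it occurs, gets the dummy value `zero`, since `r` sends that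
  -- variable to `Unit`.
  let p : Fin (Fintype.card φ.freeVarFinset) → M :=
    fun i => Sum.elim id (fun _ => zero) (e.symm i : M ⊕ Fin 1)
  let r : φ.freeVarFinset → Fin (Fintype.card φ.freeVarFinset) ⊕ Unit :=
    fun a => match a.1 with
      | Sum.inl _ => Sum.inl (e a)
      | Sum.inr _ => Sum.inr ()
  let ψ : LPA.Formula (Fin (Fintype.card φ.freeVarFinset) ⊕ Unit) := φ.restrictFreeVar r
  have hψ : ∀ y : Unit → M, ψ.Realize (Sum.elim p y) ↔ P (y ()) := by
    intro y
    rw [Formula.Realize, BoundedFormula.realize_restrictFreeVar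
      (Sum.elim id (fun _ => y ()) : M ⊕ Fin 1 → M)]
    · exact hφ _
    · rintro ⟨a | a, ha⟩
      · simp [r, p]
      · simp [r]
  have hax : M ⊨ axInduction ψ := hM.models.realize_of_mem _ (Or.inr ⟨_, ψ, rfl⟩)
  rw [axInduction, Sentence.Realize, Formula.realize_iAlls] at hax
  have h := hax p
  rw [Formula.realize_relabel] at h
  have hc : (fun a => Sum.elim (default : Empty → M) p a) ∘ (Sum.inr : _ → Empty ⊕ _) = p := rfl
  rw [hc, inductionFormula, Formula.realize_imp, Formula.realize_inf, Formula.realize_iAlls,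
    Formula.realize_iAlls] at h
  refine (hψ fun _ => x).1 (h ⟨?_, fun y => ?_⟩ _)
  · rw [Formula.Realize, BoundedFormula.realize_subst]
    convert (hψ fun _ => zero).2 h0 using 1
    rw [Formula.Realize]
    congr! 2 with a
    rcases a with a | a
    · rfl
    · simp only [Sum.elim_inr, tZero, Term.realize_func, PA.zero]
      congr 1
      exact Subsingleton.elim _ _
  · rw [Formula.realize_imp]
    intro hy
    rw [Formula.Realize, BoundedFormula.realize_subst]
    convert (hψ fun _ => succ (y ())).2 (hs _ ((hψ y).1 hy)) using 1
    rw [Formula.Realize]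
    congr! 2 with a
    rcases a with a | a
    · rfl
    · simp only [Sum.elim_inr, tSucc, Term.realize_func, PA.succ]
      congr 1
      funext i
      fin_cases i
      rfl

/-! ### The ordered semiring structure of a model of Peano arithmetic -/

section Arithmetic

variable {M : Type u} [LPA.Structure M]

theorem realize_tZero {γ : Type} (v : γ → M) : (tZero : LPA.Term γ).realize v = zero := by
  simp only [tZero, Term.realize_func, zero]
  exact congrArg _ (Subsingleton.elim (α := Fin 0 → M) _ _)

theorem realize_tSucc {γ : Type} (v : γ → M) (t : LPA.Term γ) :
    (tSucc t).realize v = succ (t.realize v) := by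
  simp only [tSucc, Term.realize_func, succ]
  congr 1; funext i; fin_cases i; rfl

theorem realize_tAdd {γ : Type} (v : γ → M) (t s : LPA.Term γ) :
    (tAdd t s).realize v = add (t.realize v) (s.realize v) := by
  simp only [tAdd, Term.realize_func, add]
  congr 1; funext i; fin_cases i <;> rfl

theorem realize_tMul {γ : Type} (v : γ → M) (t s : LPA.Term γ) :
    (tMul t s).realize v = mul (t.realize v) (s.realize v) := by
  simp only [tMul, Term.realize_func, mul]
  congr 1; funext i; fin_cases i <;> rfl

instance : Add M := ⟨add⟩

instance : Mul M := ⟨mul⟩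

instance : Zero M := ⟨zero⟩

instance : One M := ⟨succ zero⟩

theorem add_eq (x y : M) : add x y = x + y := rfl

theorem mul_eq (x y : M) : mul x y = x * y := rfl

theorem zero_eq : (zero : M) = 0 := rfl

variable [hM : PAModel M]

theorem succ_ne_zero (x : M) : succ x ≠ zero := by
  have h := hM.models.realize_of_mem axSuccNeZero (Or.inl (by simp)) x
  rw [BoundedFormula.realize_not, BoundedFormula.realize_bdEqual, realize_tSucc,
    realize_tZero] at h
  exact h

theorem succ_injective {x y : M} (hxy : succ x = succ y) : x = y := by
  have h := hM.models.realize_of_mem axSuccInj (Or.inl (by simp)) x y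
  rw [BoundedFormula.realize_imp, BoundedFormula.realize_bdEqual, realize_tSucc,
    realize_tSucc] at h
  exact h hxy

theorem add_zero' (x : M) : add x zero = x := by
  have h := hM.models.realize_of_mem axAddZero (Or.inl (by simp)) x
  rw [BoundedFormula.realize_bdEqual, realize_tAdd, realize_tZero] at h
  exact h

theorem add_succ' (x y : M) : add x (succ y) = succ (add x y) := by
  have h := hM.models.realize_of_mem axAddSucc (Or.inl (by simp)) x y
  rw [BoundedFormula.realize_bdEqual, realize_tAdd, realize_tSucc, realize_tSucc,
    realize_tAdd] at h
  exact h

theorem mul_zero' (x : M) : mul x zero = zero := by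
  have h := hM.models.realize_of_mem axMulZero (Or.inl (by simp)) x
  rw [BoundedFormula.realize_bdEqual, realize_tMul, realize_tZero] at h
  exact h

theorem mul_succ' (x y : M) : mul x (succ y) = add (mul x y) x := by
  have h := hM.models.realize_of_mem axMulSucc (Or.inl (by simp)) x y
  rw [BoundedFormula.realize_bdEqual, realize_tMul, realize_tSucc, realize_tAdd,
    realize_tMul] at h
  exact h

theorem zero_add' (x : M) : add zero x = x := by
  refine PAModel.induction (P := fun x => add zero x = x) inferInstance (add_zero' _) ?_ x
  intro x ih
  rw [add_succ', ih]

theorem succ_add' (x y : M) : add (succ x) y = succ (add x y) := by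
  refine PAModel.induction (P := fun y => add (succ x) y = succ (add x y)) inferInstance ?_ ?_ y
  · rw [add_zero', add_zero']
  · intro y ih
    rw [add_succ', ih, add_succ']

theorem add_comm' (x y : M) : add x y = add y x := by
  refine PAModel.induction (P := fun y => add x y = add y x) inferInstance ?_ ?_ y
  · rw [add_zero', zero_add']
  · intro y ih
    rw [add_succ', ih, succ_add']

theorem add_assoc' (x y z : M) : add (add x y) z = add x (add y z) := by
  refine PAModel.induction (P := fun z => add (add x y) z = add x (add y z)) inferInstance ?_ ?_ z
  · rw [add_zero', add_zero']
  · intro z ih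
    rw [add_succ', ih, add_succ', add_succ']

theorem zero_mul' (x : M) : mul zero x = zero := by
  refine PAModel.induction (P := fun x => mul zero x = zero) inferInstance (mul_zero' _) ?_ x
  intro x ih
  rw [mul_succ', ih, add_zero']

theorem succ_mul' (x y : M) : mul (succ x) y = add (mul x y) y := by
  refine PAModel.induction (P := fun y => mul (succ x) y = add (mul x y) y) inferInstance ?_ ?_ y
  · rw [mul_zero', mul_zero', add_zero']
  · intro y ih
    rw [mul_succ', ih, mul_succ', add_succ', add_succ', add_assoc', add_assoc', add_comm' y x]

theorem mul_comm' (x y : M) : mul x y = mul y x := by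
  refine PAModel.induction (P := fun y => mul x y = mul y x) inferInstance ?_ ?_ y
  · rw [mul_zero', zero_mul']
  · intro y ih
    rw [mul_succ', ih, succ_mul']

theorem mul_add' (x y z : M) : mul x (add y z) = add (mul x y) (mul x z) := by
  refine PAModel.induction (P := fun z => mul x (add y z) = add (mul x y) (mul x z))
    inferInstance ?_ ?_ z
  · rw [add_zero', mul_zero', add_zero']
  · intro z ih
    rw [add_succ', mul_succ', mul_succ', ih, add_assoc']

theorem mul_assoc' (x y z : M) : mul (mul x y) z = mul x (mul y z) := by
  refine PAModel.induction (P := fun z => mul (mul x y) z = mul x (mul y z)) inferInstance ?_ ?_ z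
  · rw [mul_zero', mul_zero', mul_zero']
  · intro z ih
    rw [mul_succ', mul_succ', mul_add', ih]

theorem one_mul' (x : M) : mul (succ zero) x = x := by
  rw [succ_mul', zero_mul', zero_add']

instance : CommSemiring M where
  add_assoc := add_assoc'
  zero_add := zero_add'
  add_zero := add_zero'
  add_comm := add_comm'
  left_distrib := mul_add'
  right_distrib x y z := by
    change mul (add x y) z = add (mul x z) (mul y z)
    rw [mul_comm', mul_add', mul_comm' z x, mul_comm' z y]
  zero_mul := zero_mul'
  mul_zero := mul_zero'
  mul_assoc := mul_assoc'
  one_mul := one_mul'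
  mul_one x := (mul_comm' _ _).trans (one_mul' x)
  mul_comm := mul_comm'
  nsmul := nsmulRec
  npow := npowRec

theorem succ_eq (x : M) : succ x = x + 1 := by
  change _ = add x (succ zero)
  rw [add_succ', add_zero']

theorem add_one_ne_zero (x : M) : x + 1 ≠ 0 := by
  rw [← succ_eq]
  exact succ_ne_zero x

theorem add_one_injective {x y : M} (h : x + 1 = y + 1) : x = y := by
  rw [← succ_eq, ← succ_eq] at h
  exact succ_injective h

theorem induction_on {P : M → Prop} (hP : DefPred (fun v : Fin 1 → M => P (v 0)))
    (h0 : P 0) (hs : ∀ x, P x → P (x + 1)) (x : M) : P x :=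
  PAModel.induction hP h0 (fun x hx => by rw [succ_eq]; exact hs x hx) x

instance TermFun.hAdd {n : ℕ} (f g : (Fin n → M) → M) [TermFun f] [TermFun g] :
    TermFun (fun v => f v + g v) :=
  TermFun.add f g

instance TermFun.hMul {n : ℕ} (f g : (Fin n → M) → M) [TermFun f] [TermFun g] :
    TermFun (fun v => f v * g v) :=
  TermFun.mul f g

theorem eq_zero_or_eq_add_one (x : M) : x = 0 ∨ ∃ y, x = y + 1 := by
  refine induction_on (P := fun x : M => x = 0 ∨ ∃ y : M, x = y + 1) inferInstance (Or.inl rfl) ?_ x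
  intro x _
  exact Or.inr ⟨x, rfl⟩

instance : IsRightCancelAdd M where
  add_right_cancel z x y := by
    refine induction_on (P := fun z => x + z = y + z → x = y) inferInstance ?_ ?_ z
    · intro h
      rwa [add_zero, add_zero] at h
    · intro z ih h
      rw [← add_assoc, ← add_assoc] at h
      exact ih (add_one_injective h)

instance : IsCancelAdd M where
  add_left_cancel z x y h := add_right_cancel (b := z) (by
    change z + x = z + y at h
    rwa [add_comm x, add_comm y])

theorem eq_zero_of_add_eq_zero {x y : M} (h : x + y = 0) : y = 0 := by
  rcases eq_zero_or_eq_add_one y with rfl | ⟨z, rfl⟩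
  · rfl
  · exact absurd h (by rw [← add_assoc]; exact add_one_ne_zero _)

theorem le_total' (x y : M) : le x y ∨ le y x := by
  refine induction_on (P := fun y => le x y ∨ le y x) inferInstance (Or.inr ⟨x, zero_add x⟩) ?_ y
  rintro y (⟨z, hz⟩ | ⟨z, hz⟩)
  · refine Or.inl ⟨z + 1, ?_⟩
    rw [add_eq] at hz ⊢
    rw [← hz, add_assoc]
  · rcases eq_zero_or_eq_add_one z with rfl | ⟨w, rfl⟩
    · refine Or.inl ⟨1, ?_⟩
      rw [add_eq] at hz ⊢
      rw [← hz, add_zero]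
    · refine Or.inr ⟨w, ?_⟩
      rw [add_eq] at hz ⊢
      rw [← hz, add_assoc, add_comm 1]

noncomputable instance : LinearOrder M where
  le := le
  le_refl x := ⟨0, add_zero x⟩
  le_trans := by
    rintro x _ _ ⟨u, rfl⟩ ⟨w, rfl⟩
    exact ⟨u + w, (add_assoc x u w).symm⟩
  le_antisymm := by
    rintro x _ ⟨u, rfl⟩ ⟨w, hw⟩
    have h : x + (u + w) = x + 0 := by rw [add_zero, ← add_assoc]; exact hw
    have hw0 := add_left_cancel h
    rw [add_comm] at hw0
    rw [eq_zero_of_add_eq_zero hw0]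
    exact (add_zero x).symm
  le_total := le_total'
  toDecidableLE := Classical.decRel _

theorem le_iff (x y : M) : le x y ↔ x ≤ y := Iff.rfl

instance : IsOrderedAddMonoid M where
  add_le_add_left := by
    rintro x _ ⟨u, rfl⟩ z
    exact ⟨u, add_right_comm x z u⟩

instance : CanonicallyOrderedAdd M where
  exists_add_of_le := by
    rintro x _ ⟨u, rfl⟩
    exact ⟨u, rfl⟩
  le_add_self x y := ⟨y, add_comm x y⟩
  le_self_add x y := ⟨y, rfl⟩

theorem lt_iff_add_one_le (x y : M) : x < y ↔ x + 1 ≤ y := by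
  constructor
  · intro h
    obtain ⟨z, rfl⟩ := exists_add_of_le h.le
    rcases eq_zero_or_eq_add_one z with rfl | ⟨w, rfl⟩
    · simp at h
    · rw [add_comm w, ← add_assoc]
      exact le_self_add
  · intro h
    refine lt_of_le_of_ne (le_trans le_self_add h) ?_
    rintro rfl
    obtain ⟨z, hz⟩ := exists_add_of_le h
    rw [add_assoc] at hz
    have := add_left_cancel ((add_zero x).trans hz)
    rw [add_comm] at this
    exact add_one_ne_zero _ this.symm

theorem lt_iff (x y : M) : lt x y ↔ x < y := by
  rw [lt_iff_add_one_le]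
  refine exists_congr fun z => ?_
  rw [succ_eq, add_eq, add_eq, add_right_comm, ← add_assoc]

theorem lt_add_one_iff' {x y : M} : x < y + 1 ↔ x ≤ y := by
  rw [lt_iff_add_one_le]
  exact add_le_add_iff_right 1

instance : Nontrivial M := ⟨⟨0, 1, by simpa using (add_one_ne_zero (0 : M)).symm⟩⟩

instance : NoZeroDivisors M where
  eq_zero_or_eq_zero_of_mul_eq_zero := by
    intro x y h
    rcases eq_zero_or_eq_add_one x with rfl | ⟨z, rfl⟩
    · exact Or.inl rfl
    · rw [add_mul, one_mul] at h
      exact Or.inr (eq_zero_of_add_eq_zero h)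

instance : IsOrderedRing M := CanonicallyOrderedAdd.toIsOrderedRing

theorem mul_lt_mul_left_of_pos {x y z : M} (hz : 0 < z) (h : x < y) : z * x < z * y := by
  obtain ⟨w, rfl⟩ := exists_add_of_le ((lt_iff_add_one_le x y).1 h)
  rw [add_assoc, mul_add]
  refine lt_add_of_pos_right _ (pos_iff_ne_zero.2 (mul_ne_zero hz.ne' ?_))
  rw [add_comm]
  exact add_one_ne_zero w

instance : IsStrictOrderedRing M where
  le_of_add_le_add_left a b c h := (add_le_add_iff_left a).1 h
  mul_lt_mul_of_pos_left _ hz _ _ h := mul_lt_mul_left_of_pos hz h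
  mul_lt_mul_of_pos_right z hz x y h := by
    rw [mul_comm x, mul_comm y]
    exact mul_lt_mul_left_of_pos hz h

theorem std_eq (n : ℕ) : (std n : M) = n := by
  induction n with
  | zero => simp [std, zero_eq]
  | succ n ih => rw [std, succ_eq, ih, Nat.cast_succ]

end Arithmetic

instance DefPred.hLe {M : Type u} [LPA.Structure M] [PAModel M] {n : ℕ}
    (f g : (Fin n → M) → M) [TermFun f] [TermFun g] : DefPred (fun v => f v ≤ g v) :=
  DefPred.le f g

instance DefPred.hLt {M : Type u} [LPA.Structure M] [PAModel M] {n : ℕ}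
    (f g : (Fin n → M) → M) [TermFun f] [TermFun g] : DefPred (fun v => f v < g v) := by
  simpa only [lt_iff] using DefPred.lt f g

/-! ### Coded sequences -/

section Coding

variable {M : Type u} [LPA.Structure M]

theorem pair_eq (x y : M) : pair x y = (x + y) * (x + y) + x := rfl

variable [hM : PAModel M]

/-- Since `x ≤ x + y`, the code of `(x, y)` stays below the next square `(x + y + 1)²`. The
difference is written out explicitly, as there is no subtraction. -/
theorem pair_lt_pair_of_add_lt {x y a b : M} (h : x + y < a + b) : pair x y < pair a b := by
  obtain ⟨e, he⟩ := exists_add_of_le ((lt_iff_add_one_le _ _).1 h)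
  have key : pair a b = pair x y + (x + 2 * y + (e * e + 2 * (x + y) * e + 2 * e + a) + 1) := by
    rw [pair_eq, pair_eq, he]
    ring
  rw [key]
  exact lt_add_of_pos_right _ (pos_iff_ne_zero.2 (add_one_ne_zero _))

theorem pair_inj {x y a b : M} : pair x y = pair a b ↔ x = a ∧ y = b := by
  constructor
  · intro h
    have hs : x + y = a + b := by
      rcases lt_trichotomy (x + y) (a + b) with h1 | h1 | h1
      · exact absurd h (pair_lt_pair_of_add_lt h1).ne
      · exact h1
      · exact absurd h (pair_lt_pair_of_add_lt h1).ne'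
    rw [pair_eq, pair_eq, hs] at h
    obtain rfl := add_left_cancel h
    exact ⟨rfl, add_left_cancel hs⟩
  · rintro ⟨rfl, rfl⟩
    rfl

theorem exists_div (a : M) {m : M} (hm : 0 < m) : ∃ q r, a = q * m + r ∧ r < m := by
  refine induction_on (P := fun a => ∃ q r, a = q * m + r ∧ r < m) inferInstance
    ⟨0, 0, by rw [zero_mul, zero_add], hm⟩ ?_ a
  rintro _ ⟨q, r, rfl, hr⟩
  rcases ((lt_iff_add_one_le _ _).1 hr).lt_or_eq with h | h
  · exact ⟨q, r + 1, add_assoc _ _ _, h⟩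
  · exact ⟨q + 1, 0, by rw [add_assoc, h, add_zero, add_mul, one_mul], hm⟩

theorem le_of_div_eq {m q q' r r' : M} (hr : r < m) (h : q * m + r = q' * m + r') :
    q' ≤ q := by
  by_contra! hlt
  obtain ⟨e, rfl⟩ := exists_add_of_le ((lt_iff_add_one_le _ _).1 hlt)
  have h2 : r = m + (e * m + r') := by
    apply add_left_cancel (a := q * m)
    rw [h]
    ring
  exact absurd hr (not_lt.2 (h2 ▸ le_self_add))

theorem rem_unique {m q q' r r' : M} (hr : r < m) (hr' : r' < m)
    (h : q * m + r = q' * m + r') : r = r' := by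
  obtain rfl := le_antisymm (le_of_div_eq hr' h.symm) (le_of_div_eq hr h)
  exact add_left_cancel h

/-- The modulus of Gödel's `β`-function. -/
abbrev modulus (b i : M) : M := (i + 1) * b + 1

theorem elem_iff {s i z : M} : Elem s i z ↔
    ∃ a b q, s = pair a b ∧ a = q * modulus b i + z ∧ z < modulus b i := by
  simp only [Elem, lt_iff, succ_eq, add_eq, mul_eq]

theorem Elem.unique {s i z z' : M} (h : Elem s i z) (h' : Elem s i z') : z = z' := by
  obtain ⟨a, b, q, rfl, ha, hz⟩ := elem_iff.1 h
  obtain ⟨a', b', q', hs, ha', hz'⟩ := elem_iff.1 h'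
  obtain ⟨rfl, rfl⟩ := pair_inj.1 hs
  exact rem_unique hz hz' (ha.symm.trans ha')

/-- Pairing is not surjective; one known entry shows that `s` is a pair, and then division with
remainder gives an entry at every index. -/
theorem Elem.total {s i z : M} (h : Elem s i z) (j : M) : ∃ w, Elem s j w := by
  obtain ⟨a, b, q, rfl, -, -⟩ := elem_iff.1 h
  obtain ⟨q', r, h1, h2⟩ := exists_div a (m := modulus b j) (pos_iff_ne_zero.2 (add_one_ne_zero _))
  exact ⟨r, elem_iff.2 ⟨a, b, q', rfl, h1, h2⟩⟩

/-- A Bézout identity without subtraction. Put `J = i + d + 1`. Modulo `J * b + 1`, `J * modulus b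
i` is congruent to `d`, and `J * b` to `-1`. Hence `1` is congruent to `(J * b)² = J² * b * e * d`,
thus to `J³ * e * b * modulus b i`. The auxiliary `w` is `J * b - 1`. -/
theorem modulus_coprime {i d e b : M} (hb : b = d * e) (hpos : 0 < b) :
    ∃ x y, modulus b i * x = y * modulus b (i + d) + 1 := by
  have hJ : 0 < (i + d + 1) * b := mul_pos (pos_iff_ne_zero.2 (add_one_ne_zero _)) hpos
  obtain ⟨w, hw⟩ := (eq_zero_or_eq_add_one ((i + d + 1) * b)).resolve_left hJ.ne'
  refine ⟨(i + d + 1) * (i + d + 1) * (i + d + 1) * e * b,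
    (i + d + 1) * (i + d + 1) * e * b * (i + 1) + w, ?_⟩
  have h1 : ((i + d + 1) * b) * ((i + d + 1) * b) = w * ((i + d + 1) * b + 1) + 1 := by
    rw [hw]
    ring
  calc modulus b i * ((i + d + 1) * (i + d + 1) * (i + d + 1) * e * b)
      = (i + d + 1) * (i + d + 1) * e * b * (i + 1) * modulus b (i + d)
          + (i + d + 1) * ((i + d + 1) * b) * (d * e) := by ring
    _ = (i + d + 1) * (i + d + 1) * e * b * (i + 1) * modulus b (i + d)
          + ((i + d + 1) * b) * ((i + d + 1) * b) := by rw [← hb]; ring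
    _ = _ := by rw [h1]; ring

theorem exists_common_multiple (n : M) :
    ∃ L, 0 < L ∧ ∀ d, 0 < d → d ≤ n → ∃ e, L = d * e := by
  refine induction_on (P := fun n => ∃ L, 0 < L ∧ ∀ d, 0 < d → d ≤ n → ∃ e, L = d * e)
    inferInstance ⟨1, zero_lt_one, fun d hd hd0 => absurd hd (not_lt.2 hd0)⟩ ?_ n
  rintro n ⟨L, hL, h⟩
  -- The common multiple built here is the factorial.
  refine ⟨(n + 1) * L, mul_pos (pos_iff_ne_zero.2 (add_one_ne_zero _)) hL, fun d hd hdn => ?_⟩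
  rcases hdn.lt_or_eq with hlt | rfl
  · obtain ⟨e, rfl⟩ := h d hd (lt_add_one_iff'.1 hlt)
    exact ⟨(n + 1) * e, by ring⟩
  · exact ⟨L, rfl⟩

/-- Collection for a functional relation: the bound grows by the new value at each step of an
induction on the length. -/
theorem exists_bound {R : M → M → Prop} (hR : DefPred (fun v : Fin 2 → M => R (v 0) (v 1)))
    (c : M) (hu : ∀ i ≤ c, ∀ z z', R i z → R i z' → z = z') :
    ∃ B, ∀ i ≤ c, ∀ z, R i z → z ≤ B := by
  have inst : ∀ {n : ℕ} (f g : (Fin n → M) → M) [TermFun f] [TermFun g],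
    DefPred (fun v => R (f v) (g v)) := fun f g => hR.comp2 f g
  have key : ∀ n, ∃ B, ∀ i ≤ c, i < n → ∀ z, R i z → z ≤ B := by
    intro n
    refine induction_on (P := fun n => ∃ B, ∀ i ≤ c, i < n → ∀ z, R i z → z ≤ B)
      inferInstance ⟨0, fun i _ hi => absurd hi not_lt_zero⟩ ?_ n
    rintro n ⟨B, hB⟩
    by_cases hn : ∃ w, n ≤ c ∧ R n w
    · obtain ⟨w, hnc, hw⟩ := hn
      refine ⟨B + w, fun i hic hi z hz => ?_⟩
      rcases (lt_add_one_iff'.1 hi).lt_or_eq with hlt | rfl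
      · exact (hB i hic hlt z hz).trans le_self_add
      · exact (hu i hic z w hz hw).le.trans le_add_self
    · refine ⟨B, fun i hic hi z hz => ?_⟩
      rcases (lt_add_one_iff'.1 hi).lt_or_eq with hlt | rfl
      · exact hB i hic hlt z hz
      · exact absurd ⟨z, hic, hz⟩ hn
  obtain ⟨B, hB⟩ := key (c + 1)
  exact ⟨B, fun i hi => hB i hi (lt_add_one_iff'.2 hi)⟩

/-- The Chinese remainder theorem for a definable family of residues. -/
theorem exists_residues {R : M → M → Prop}
    (hR : DefPred (fun v : Fin 2 → M => R (v 0) (v 1))) (b c : M) (hb : 0 < b)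
    (hdvd : ∀ d, 0 < d → d ≤ c → ∃ e, b = d * e)
    (hex : ∀ i ≤ c, ∃ z, R i z) (hu : ∀ i ≤ c, ∀ z z', R i z → R i z' → z = z') :
    ∃ a, ∀ i ≤ c, ∀ z, R i z → ∃ q, a = q * modulus b i + z := by
  have inst : ∀ {n : ℕ} (f g : (Fin n → M) → M) [TermFun f] [TermFun g],
    DefPred (fun v => R (f v) (g v)) := fun f g => hR.comp2 f g
  -- Here `a` solves the congruences below `n`, while `m` is a common multiple of the moduli used so
  -- far and is coprime to the remaining ones.
  have key : ∀ n, ∃ a m, (∀ i ≤ c, i < n → ∀ z, R i z → ∃ q, a = q * ((i + 1) * b + 1) + z) ∧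
      (∀ i ≤ c, i < n → ∃ k, m = ((i + 1) * b + 1) * k) ∧
      ∀ j ≤ c, n ≤ j → ∃ x y, m * x = y * ((j + 1) * b + 1) + 1 := by
    intro n
    refine induction_on (P := fun n =>
      ∃ a m, (∀ i ≤ c, i < n → ∀ z, R i z → ∃ q, a = q * ((i + 1) * b + 1) + z) ∧
      (∀ i ≤ c, i < n → ∃ k, m = ((i + 1) * b + 1) * k) ∧
      ∀ j ≤ c, n ≤ j → ∃ x y, m * x = y * ((j + 1) * b + 1) + 1) inferInstance ?_ ?_ n
    · exact ⟨0, 1, fun i _ hi => absurd hi not_lt_zero, fun i _ hi => absurd hi not_lt_zero,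
        fun j _ _ => ⟨1, 0, by ring⟩⟩
    rintro n ⟨a, m, h1, h2, h3⟩
    by_cases hnc : n ≤ c
    · obtain ⟨w, hw⟩ := hex n hnc
      obtain ⟨x, y, hxy⟩ := h3 n hnc le_rfl
      -- The correction is a multiple of `m`, so old residues survive. Modulo `modulus b n`, `m * x`
      -- is `1` and `a * ((n + 1) * b)` acts as `-a`, so the new residue is `w`.
      refine ⟨a + m * x * (w + a * ((n + 1) * b)), m * modulus b n, ?_, ?_, ?_⟩
      · intro i hic hi z hz
        rcases (lt_add_one_iff'.1 hi).lt_or_eq with hlt | rfl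
        · obtain ⟨q, hq⟩ := h1 i hic hlt z hz
          obtain ⟨k, hk⟩ := h2 i hic hlt
          refine ⟨q + k * x * (w + a * ((n + 1) * b)), ?_⟩
          rw [hk]
          nth_rw 1 [hq]
          ring
        · obtain rfl := hu i hic z w hz hw
          refine ⟨a + y * (z + a * ((i + 1) * b)), ?_⟩
          rw [hxy]
          ring
      · intro i hic hi
        rcases (lt_add_one_iff'.1 hi).lt_or_eq with hlt | rfl
        · obtain ⟨k, hk⟩ := h2 i hic hlt
          exact ⟨k * modulus b n, by rw [hk]; ring⟩
        · exact ⟨m, mul_comm _ _⟩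
      · intro j hjc hj
        obtain ⟨x', y', hxy'⟩ := h3 j hjc (le_self_add.trans hj)
        obtain ⟨d, rfl⟩ := exists_add_of_le (le_self_add.trans hj : n ≤ j)
        have hd : 0 < d := by
          rw [← lt_iff_add_one_le] at hj
          exact pos_of_lt_add_right hj
        obtain ⟨e, he⟩ := hdvd d hd (le_add_self.trans hjc)
        obtain ⟨x'', y'', hxy''⟩ := modulus_coprime (i := n) he hb
        refine ⟨x' * x'', y' * y'' * modulus b (n + d) + y' + y'', ?_⟩
        calc m * modulus b n * (x' * x'') = (m * x') * (modulus b n * x'') := by ring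
          _ = _ := by rw [hxy', hxy'']; ring
    · refine ⟨a, m, fun i hic hi => h1 i hic ?_, fun i hic hi => h2 i hic ?_,
        fun j hjc hj => absurd (le_self_add.trans (hj.trans hjc)) hnc⟩ <;>
      exact lt_of_le_of_lt hic (not_le.1 hnc)
  obtain ⟨a, m, h1, -, -⟩ := key (c + 1)
  exact ⟨a, fun i hi => h1 i hi (lt_add_one_iff'.2 hi)⟩

/-- Every definable sequence of length `c + 1` is coded. -/
theorem exists_code {R : M → M → Prop} (hR : DefPred (fun v : Fin 2 → M => R (v 0) (v 1)))
    (c : M) (hex : ∀ i ≤ c, ∃ z, R i z) (hu : ∀ i ≤ c, ∀ z z', R i z → R i z' → z = z') :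
    ∃ s, ∀ i ≤ c, ∀ z, R i z → Elem s i z := by
  obtain ⟨B, hB⟩ := exists_bound hR c hu
  obtain ⟨L, hL, hdvd⟩ := exists_common_multiple c
  have hB1 : 0 < B + 1 := pos_iff_ne_zero.2 (add_one_ne_zero _)
  -- The factor `L` makes the moduli pairwise coprime; the factor `B + 1` makes each of them exceed
  -- every value to be coded.
  obtain ⟨a, ha⟩ := exists_residues hR (L * (B + 1)) c (mul_pos hL hB1)
    (fun d hd hdc => by
      obtain ⟨e, rfl⟩ := hdvd d hd hdc
      exact ⟨e * (B + 1), mul_assoc _ _ _⟩) hex hu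
  refine ⟨pair a (L * (B + 1)), fun i hi z hz => ?_⟩
  obtain ⟨q, hq⟩ := ha i hi z hz
  refine elem_iff.2 ⟨a, _, q, rfl, hq, ?_⟩
  rw [lt_add_one_iff']
  have h1 : (1 : M) ≤ L := by
    have := (lt_iff_add_one_le _ _).1 hL
    rwa [zero_add] at this
  calc z ≤ B := hB i hi z hz
    _ ≤ B + 1 := le_self_add
    _ ≤ L * (B + 1) := le_mul_of_one_le_left hB1.le h1
    _ ≤ (i + 1) * (L * (B + 1)) := le_mul_of_one_le_left (mul_pos hL hB1).le le_add_self

end Coding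

/-! ### Generated predicates and the syntax of sentences -/

section Syntactic

variable {M : Type u} [LPA.Structure M]

/-- More available earlier terms allow more steps. -/
def MonotoneStep (step : (M → Prop) → M → Prop) : Prop :=
  ∀ P Q : M → Prop, (∀ z, P z → Q z) → ∀ y, step P y → step Q y

theorem isForm_step_mono : MonotoneStep (fun (P : M → Prop) y =>
    (∃ t u, IsTerm t ∧ IsTerm u ∧ y = cEq t u) ∨ (∃ φ, P φ ∧ y = cNeg φ) ∨
      (∃ φ ψ, P φ ∧ P ψ ∧ y = cOr φ ψ) ∨ (∃ v φ, P φ ∧ y = cEx v φ)) := by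
  rintro P Q h y (h1 | ⟨φ, h1, rfl⟩ | ⟨φ, ψ, h1, h2, rfl⟩ | ⟨v, φ, h1, rfl⟩)
  · exact Or.inl h1
  · exact Or.inr (Or.inl ⟨φ, h _ h1, rfl⟩)
  · exact Or.inr (Or.inr (Or.inl ⟨φ, ψ, h _ h1, h _ h2, rfl⟩))
  · exact Or.inr (Or.inr (Or.inr ⟨v, φ, h _ h1, rfl⟩))

theorem freeIn_step_mono (v : M) : MonotoneStep (fun (P : M → Prop) y =>
    (∃ t u, (OccursIn v t ∨ OccursIn v u) ∧ y = cEq t u) ∨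
      (∃ φ, P φ ∧ y = cNeg φ) ∨ (∃ φ ψ, (P φ ∨ P ψ) ∧ y = cOr φ ψ) ∨
      (∃ w φ, w ≠ v ∧ P φ ∧ y = cEx w φ)) := by
  rintro P Q h y (h1 | ⟨φ, h1, rfl⟩ | ⟨φ, ψ, h1, rfl⟩ | ⟨w, φ, hw, h1, rfl⟩)
  · exact Or.inl h1
  · exact Or.inr (Or.inl ⟨φ, h _ h1, rfl⟩)
  · exact Or.inr (Or.inr (Or.inl ⟨φ, ψ, h1.imp (h _) (h _), rfl⟩))
  · exact Or.inr (Or.inr (Or.inr ⟨w, φ, hw, h _ h1, rfl⟩))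

variable [hM : PAModel M]

/-- Inversion: each initial segment of a derivation is a derivation, given by the same code with a
smaller last index. -/
theorem Gen.cases {step : (M → Prop) → M → Prop} (hmono : MonotoneStep step) {y : M}
    (h : Gen step y) : step (Gen step) y := by
  obtain ⟨s, l, hl, hg⟩ := h
  obtain ⟨y', hy', hstep⟩ := hg l ((le_iff _ _).2 le_rfl)
  obtain rfl := hl.unique hy'
  refine hmono _ _ ?_ _ hstep
  rintro z ⟨j, hj, hz⟩
  rw [lt_iff] at hj
  exact ⟨s, j, hz, fun i hi => hg i (le_trans ((le_iff _ _).1 hi) hj.le)⟩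

theorem le_concat_cases {i l₁ l₂ : M} (hi : i ≤ l₁ + 1 + (l₂ + 1)) :
    i ≤ l₁ ∨ (∃ k ≤ l₂, i = l₁ + 1 + k) ∨ i = l₁ + 1 + (l₂ + 1) := by
  rcases le_or_gt i l₁ with h | h
  · exact Or.inl h
  · obtain ⟨k, rfl⟩ := exists_add_of_le ((lt_iff_add_one_le _ _).1 h)
    rcases (le_of_add_le_add_left hi).lt_or_eq with h2 | rfl
    · exact Or.inr (Or.inl ⟨k, lt_add_one_iff'.1 h2, rfl⟩)
    · exact Or.inr (Or.inr rfl)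

theorem exists_concat {s₁ l₁ s₂ l₂ a b : M} (ha : Elem s₁ l₁ a) (hb : Elem s₂ l₂ b) (y : M) :
    ∃ s, (∀ i ≤ l₁, ∀ z, Elem s₁ i z → Elem s i z) ∧
      (∀ k ≤ l₂, ∀ z, Elem s₂ k z → Elem s (l₁ + 1 + k) z) ∧ Elem s (l₁ + 1 + (l₂ + 1)) y := by
  have not_le : ∀ k, ¬ l₁ + 1 + k ≤ l₁ := fun k h =>
    absurd ((lt_iff_add_one_le _ _).2 (le_self_add.trans h)) (lt_irrefl _)
  have not_le2 : ¬ l₂ + 1 ≤ l₂ := fun h => absurd ((lt_iff_add_one_le _ _).2 h) (lt_irrefl _)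
  -- The second block starts at `l₁ + 1`, and `y` takes the one position after it. The offset `k`
  -- replaces the subtraction `i - (l₁ + 1)`.
  obtain ⟨s, hs⟩ := exists_code (R := fun i z => (i ≤ l₁ → Elem s₁ i z) ∧
      ∀ k, i = l₁ + 1 + k → (k ≤ l₂ → Elem s₂ k z) ∧ (k = l₂ + 1 → z = y))
    inferInstance (l₁ + 1 + (l₂ + 1)) (fun i hi => by
      rcases le_concat_cases hi with h | ⟨k, hk, rfl⟩ | rfl
      · obtain ⟨z, hz⟩ := ha.total i
        refine ⟨z, fun _ => hz, ?_⟩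
        rintro k rfl
        exact absurd h (not_le k)
      · obtain ⟨z, hz⟩ := hb.total k
        refine ⟨z, fun h => absurd h (not_le k), fun k' hk' => ?_⟩
        obtain rfl := add_left_cancel hk'
        refine ⟨fun _ => hz, ?_⟩
        rintro rfl
        exact absurd hk not_le2
      · refine ⟨y, fun h => absurd h (not_le _), fun k' hk' => ?_⟩
        obtain rfl := add_left_cancel hk'
        exact ⟨fun h => absurd h not_le2, fun _ => rfl⟩)
    (fun i hi z z' hz hz' => by
      rcases le_concat_cases hi with h | ⟨k, hk, rfl⟩ | rfl
      · exact (hz.1 h).unique (hz'.1 h)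
      · exact ((hz.2 k rfl).1 hk).unique ((hz'.2 k rfl).1 hk)
      · exact ((hz.2 _ rfl).2 rfl).trans ((hz'.2 _ rfl).2 rfl).symm)
  refine ⟨s, fun i hi z hz => ?_, fun k hk z hz => ?_, ?_⟩
  · refine hs i (hi.trans (by rw [add_assoc]; exact le_self_add)) z ⟨fun _ => hz, ?_⟩
    rintro k rfl
    exact absurd hi (not_le k)
  · refine hs _ (add_le_add_right (hk.trans le_self_add) _) z
      ⟨fun h => absurd h (not_le k), fun k' hk' => ?_⟩
    obtain rfl := add_left_cancel hk'
    refine ⟨fun _ => hz, ?_⟩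
    rintro rfl
    exact absurd hk not_le2
  · refine hs _ le_rfl y ⟨fun h => absurd h (not_le _), fun k' hk' => ?_⟩
    obtain rfl := add_left_cancel hk'
    exact ⟨fun h => absurd h not_le2, fun _ => rfl⟩

/-- Derivations of `a` and `b` are concatenated and `y` is appended; monotonicity keeps the old
steps valid. A unary rule is the case `a = b`. -/
theorem Gen.intro {step : (M → Prop) → M → Prop} (hmono : MonotoneStep step) {a b y : M}
    (ha : Gen step a) (hb : Gen step b) (hy : step (fun z => z = a ∨ z = b) y) :
    Gen step y := by
  obtain ⟨s₁, l₁, ha, h₁⟩ := ha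
  obtain ⟨s₂, l₂, hb, h₂⟩ := hb
  obtain ⟨s, hs₁, hs₂, hs⟩ := exists_concat ha hb y
  refine ⟨s, _, hs, fun i hi => ?_⟩
  rcases le_concat_cases ((le_iff _ _).1 hi) with h | ⟨k, hk, rfl⟩ | rfl
  · obtain ⟨z, hz, hstep⟩ := h₁ i h
    refine ⟨z, hs₁ i h z hz, hmono _ _ ?_ _ hstep⟩
    rintro w ⟨j, hj, hw⟩
    exact ⟨j, hj, hs₁ j (((lt_iff _ _).1 hj).le.trans h) w hw⟩
  · obtain ⟨z, hz, hstep⟩ := h₂ k hk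
    refine ⟨z, hs₂ k hk z hz, hmono _ _ ?_ _ hstep⟩
    rintro w ⟨j, hj, hw⟩
    rw [lt_iff] at hj
    exact ⟨l₁ + 1 + j, (lt_iff _ _).2 (add_lt_add_right hj _), hs₂ j (hj.le.trans hk) w hw⟩
  · refine ⟨y, hs, hmono _ _ ?_ _ hy⟩
    rintro w (rfl | rfl)
    · refine ⟨l₁, (lt_iff _ _).2 ?_, hs₁ l₁ le_rfl _ ha⟩
      rw [lt_iff_add_one_le]
      exact le_self_add
    · refine ⟨l₁ + 1 + l₂, (lt_iff _ _).2 (add_lt_add_right ?_ _), hs₂ l₂ le_rfl _ hb⟩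
      exact lt_add_one_iff'.2 le_rfl

theorem std_inj {m n : ℕ} : (std m : M) = std n ↔ m = n := by
  rw [std_eq, std_eq, Nat.cast_inj]

theorem cNeg_inj {φ ψ : M} : cNeg φ = cNeg ψ ↔ φ = ψ := by
  simp [cNeg, pair_inj]

theorem cOr_inj {φ ψ φ' ψ' : M} : cOr φ ψ = cOr φ' ψ' ↔ φ = φ' ∧ ψ = ψ' := by
  simp [cOr, pair_inj]

theorem IsForm.neg {φ : M} (h : IsForm φ) : IsForm (cNeg φ) :=
  Gen.intro isForm_step_mono h h (Or.inr (Or.inl ⟨φ, Or.inl rfl, rfl⟩))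

theorem IsForm.or {φ ψ : M} (h : IsForm φ) (h' : IsForm ψ) : IsForm (cOr φ ψ) :=
  Gen.intro isForm_step_mono h h'
    (Or.inr (Or.inr (Or.inl ⟨φ, ψ, Or.inl rfl, Or.inr rfl, rfl⟩)))

/-- Pairing is injective and distinct standard tags stay distinct in `M`, so only the negation
clause can have produced this code. -/
theorem FreeIn.of_neg {v φ : M} (h : FreeIn v (cNeg φ)) : FreeIn v φ := by
  rcases Gen.cases (freeIn_step_mono v) h with
    ⟨_, _, _, h1⟩ | ⟨ψ, h1, h2⟩ | ⟨_, _, _, h1⟩ | ⟨_, _, _, _, h1⟩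
  · simp [cNeg, cEq, pair_inj, std_inj] at h1
  · rw [cNeg_inj.1 h2]
    exact h1
  · simp [cNeg, cOr, pair_inj, std_inj] at h1
  · simp [cNeg, cEx, pair_inj, std_inj] at h1

theorem FreeIn.of_or {v φ ψ : M} (h : FreeIn v (cOr φ ψ)) : FreeIn v φ ∨ FreeIn v ψ := by
  rcases Gen.cases (freeIn_step_mono v) h with
    ⟨_, _, _, h1⟩ | ⟨_, _, h1⟩ | ⟨_, _, h1, h2⟩ | ⟨_, _, _, _, h1⟩
  · simp [cOr, cEq, pair_inj, std_inj] at h1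
  · simp [cOr, cNeg, pair_inj, std_inj] at h1
  · obtain ⟨rfl, rfl⟩ := cOr_inj.1 h2
    exact h1
  · simp [cOr, cEx, pair_inj, std_inj] at h1

theorem IsSent.neg {φ : M} (h : IsSent φ) : IsSent (cNeg φ) :=
  ⟨h.1.neg, fun v hv => h.2 v hv.of_neg⟩

theorem IsSent.or {φ ψ : M} (h : IsSent φ) (h' : IsSent ψ) : IsSent (cOr φ ψ) :=
  ⟨h.1.or h'.1, fun v hv => hv.of_or.elim (h.2 v) (h'.2 v)⟩

theorem IsSent.and {φ ψ : M} (h : IsSent φ) (h' : IsSent ψ) : IsSent (cAnd φ ψ) :=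
  (h.neg.or h'.neg).neg

theorem IsSent.imp {φ ψ : M} (h : IsSent φ) (h' : IsSent ψ) : IsSent (cImp φ ψ) :=
  h.neg.or h'

end Syntactic

/-! ### Truth of the derived connectives -/

namespace IsCTMinus

variable {M : Type u} [LPA.Structure M] [PAModel M] {T : Set M}

theorem and_iff (hT : IsCTMinus M T) {φ ψ : M} (h : IsSent φ) (h' : IsSent ψ) :
    cAnd φ ψ ∈ T ↔ φ ∈ T ∧ ψ ∈ T := by
  rw [cAnd, hT.neg _ (h.neg.or h'.neg), hT.or _ _ h.neg h'.neg, hT.neg _ h, hT.neg _ h']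
  tauto

theorem imp_iff (hT : IsCTMinus M T) {φ ψ : M} (h : IsSent φ) (h' : IsSent ψ) :
    cImp φ ψ ∈ T ↔ (φ ∈ T → ψ ∈ T) := by
  rw [cImp, hT.or _ _ h.neg h', hT.neg _ h]
  tauto

end IsCTMinus

/-! ### Disjunctions with stopping condition -/

section StoppingDisj

variable {M : Type u} [LPA.Structure M]

/-- `(α → β) ∧ ((α ∧ β) ∨ (¬ α ∧ δ))` -/
def stoppingStep (α β δ : M) : M :=
  cAnd (cImp α β) (cOr (cAnd α β) (cAnd (cNeg α) δ))

instance TermFun.stoppingStep {n : ℕ} (f g h : (Fin n → M) → M) [TermFun f] [TermFun g]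
    [TermFun h] : TermFun (fun v => stoppingStep (f v) (g v) (h v)) := by
  unfold PA.stoppingStep; infer_instance

variable [hM : PAModel M]

theorem IsSent.stoppingStep {α β δ : M} (hα : IsSent α) (hβ : IsSent β) (hδ : IsSent δ) :
    IsSent (stoppingStep α β δ) :=
  (hα.imp hβ).and ((hα.and hβ).or (hα.neg.and hδ))

theorem IsCTMinus.stoppingStep_iff {T : Set M} (hT : IsCTMinus M T) {α β δ : M}
    (hα : IsSent α) (hβ : IsSent β) (hδ : IsSent δ) :
    stoppingStep α β δ ∈ T ↔ (α ∈ T ∧ β ∈ T) ∨ (α ∉ T ∧ δ ∈ T) := by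
  rw [stoppingStep, hT.and_iff (hα.imp hβ) ((hα.and hβ).or (hα.neg.and hδ)),
    hT.imp_iff hα hβ, hT.or _ _ (hα.and hβ) (hα.neg.and hδ), hT.and_iff hα hβ,
    hT.and_iff hα.neg hδ, hT.neg _ hα]
  tauto

/-- `d` satisfies the backward recursion that defines the disjunctions with stopping condition. -/
def StoppingRec (c : M) (α β d : M → M) : Prop :=
  d c = cAnd (α c) (β c) ∧ ∀ i < c, d i = stoppingStep (α i) (β i) (d (i + 1))

theorem isStoppingDisj_iff {c : M} {α β : M → M} {a δ : M} :
    IsStoppingDisj c α β a δ ↔ ∃ d : M → M, CodedSeq c d ∧ StoppingRec c α β d ∧ d a = δ := by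
  simp only [IsStoppingDisj, StoppingRec, stoppingStep, lt_iff, succ_eq, and_assoc]

/-- The recursion is solved on the last `n + 1` indices, by induction on `n`. Entries are read off
`sα` and `sβ`, so the induction predicate is definable. -/
theorem exists_stopping_code {c sα sβ : M} {α β : M → M} (hα : ∀ i ≤ c, Elem sα i (α i))
    (hβ : ∀ i ≤ c, Elem sβ i (β i)) (n : M) :
    ∃ s, ∀ i ≤ c, c ≤ i + n → ∀ x y, Elem sα i x → Elem sβ i y →
      (i = c → Elem s i (cAnd x y)) ∧
      (i < c → ∃ w, Elem s (i + 1) w ∧ Elem s i (stoppingStep x y w)) := by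
  refine induction_on (P := fun n => ∃ s, ∀ i ≤ c, c ≤ i + n → ∀ x y, Elem sα i x → Elem sβ i y →
      (i = c → Elem s i (cAnd x y)) ∧
      (i < c → ∃ w, Elem s (i + 1) w ∧ Elem s i (stoppingStep x y w))) inferInstance ?_ ?_ n
  -- Only the entry at `c` is constrained, so a constant sequence will do.
  · obtain ⟨s, hs⟩ := exists_code (R := fun _ z => z = cAnd (α c) (β c)) inferInstance c
      (fun _ _ => ⟨_, rfl⟩) (fun _ _ _ _ h h' => h.trans h'.symm)
    refine ⟨s, fun i hi hci x y hx hy => ⟨?_, fun h => ?_⟩⟩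
    · rintro rfl
      rw [hx.unique (hα i hi), hy.unique (hβ i hi)]
      exact hs i hi _ rfl
    · rw [add_zero] at hci
      exact absurd h (not_lt.2 hci)
  · rintro n ⟨s, hs⟩
    by_cases hn : n + 1 ≤ c
    -- The new index is `k = c - (n + 1)`; the sequence is recoded with this single entry
    -- overwritten.
    · obtain ⟨k, rfl⟩ := exists_add_of_le hn
      have hkc : k < n + 1 + k := lt_add_of_pos_left _ (pos_iff_ne_zero.2 (add_one_ne_zero _))
      have htot : ∀ i, ∃ z, Elem s i z :=
        ((hs _ le_rfl le_self_add _ _ (hα _ le_rfl) (hβ _ le_rfl)).1 rfl).total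
      obtain ⟨w, hw⟩ := htot (k + 1)
      obtain ⟨s', hs'⟩ := exists_code
        (R := fun i z => (i = k → z = stoppingStep (α k) (β k) w) ∧ (i ≠ k → Elem s i z))
        inferInstance (n + 1 + k) (fun i _ => by
          by_cases hik : i = k
          · exact ⟨_, fun _ => rfl, fun h => absurd hik h⟩
          · obtain ⟨z, hz⟩ := htot i
            exact ⟨z, fun h => absurd h hik, fun _ => hz⟩)
        (fun i _ z z' hz hz' => by
          by_cases hik : i = k
          · exact (hz.1 hik).trans (hz'.1 hik).symm
          · exact (hz.2 hik).unique (hz'.2 hik))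
      have hne : ∀ i, k < i → i ≤ n + 1 + k → ∀ z, Elem s i z → Elem s' i z :=
        fun i hki hi z hz => hs' i hi z ⟨fun h => absurd h hki.ne', fun _ => hz⟩
      refine ⟨s', fun i hi hci x y hx hy => ?_⟩
      have hki : k ≤ i := by
        rw [add_comm] at hci
        exact le_of_add_le_add_right hci
      rcases hki.lt_or_eq with hlt | rfl
      · have hold := hs i hi (by
          rw [add_comm (n + 1), add_comm n, ← add_assoc]
          exact add_le_add_left ((lt_iff_add_one_le _ _).1 hlt) n) x y hx hy
        refine ⟨fun h => hne i hlt hi _ (hold.1 h), fun h => ?_⟩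
        obtain ⟨w', hw', hw2⟩ := hold.2 h
        exact ⟨w', hne _ (lt_add_one_iff'.2 hki) ((lt_iff_add_one_le _ _).1 h) _ hw',
          hne i hlt hi _ hw2⟩
      · refine ⟨fun h => absurd h hkc.ne, fun h => ⟨w, ?_, ?_⟩⟩
        · exact hne _ (lt_add_one_iff'.2 le_rfl) ((lt_iff_add_one_le _ _).1 h) _ hw
        · rw [hx.unique (hα k hi), hy.unique (hβ k hi)]
          exact hs' k hi _ ⟨fun _ => rfl, fun h => absurd rfl h⟩
    · refine ⟨s, fun i hi _ => hs i hi ?_⟩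
      rw [← lt_iff_add_one_le, not_lt] at hn
      exact hn.trans le_add_self

theorem exists_stoppingRec {c : M} {α β : M → M} (hα : CodedSeq c α) (hβ : CodedSeq c β) :
    ∃ d : M → M, CodedSeq c d ∧ StoppingRec c α β d := by
  obtain ⟨sα, hα⟩ := hα
  obtain ⟨sβ, hβ⟩ := hβ
  obtain ⟨s, hs⟩ := exists_stopping_code hα hβ c
  have hs' := fun i hi => hs i hi le_add_self _ _ (hα i hi) (hβ i hi)
  -- Values of `d` beyond `c` are whatever the code yields there; the recursion does not use them.
  choose d hd using ((hs' c le_rfl).1 rfl).total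
  refine ⟨d, ⟨s, fun i _ => hd i⟩, (hd c).unique ((hs' c le_rfl).1 rfl), fun i hi => ?_⟩
  obtain ⟨w, hw, hi'⟩ := (hs' i hi.le).2 hi
  rw [(hd (i + 1)).unique hw]
  exact (hd i).unique hi'

/-- Backward induction from `c` for definable properties. -/
theorem backward_induction {c : M} {P : M → Prop}
    (hP : DefPred (fun v : Fin 1 → M => P (v 0))) (hc : P c) (hs : ∀ i < c, P (i + 1) → P i) :
    ∀ i ≤ c, P i := by
  have inst : ∀ {n : ℕ} (f : (Fin n → M) → M) [TermFun f], DefPred (fun v => P (f v)) :=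
    fun f => hP.comp1 f
  have key : ∀ n, ∀ i ≤ c, c ≤ i + n → P i := by
    intro n
    refine induction_on (P := fun n => ∀ i ≤ c, c ≤ i + n → P i) inferInstance ?_ ?_ n
    · intro i hi hci
      rw [add_zero] at hci
      rwa [le_antisymm hi hci]
    · intro n ih i hi hci
      rcases hi.lt_or_eq with hlt | rfl
      · refine hs i hlt (ih _ ((lt_iff_add_one_le _ _).1 hlt) ?_)
        rwa [add_assoc, add_comm 1]
      · exact hc
  exact fun i hi => key c i hi le_add_self

theorem StoppingRec.unique {c : M} {α β d d' : M → M} (hd : CodedSeq c d) (hd' : CodedSeq c d')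
    (h : StoppingRec c α β d) (h' : StoppingRec c α β d') : ∀ i ≤ c, d i = d' i := by
  obtain ⟨s, hs⟩ := hd
  obtain ⟨s', hs'⟩ := hd'
  have key := backward_induction (c := c)
    (P := fun i => i ≤ c → ∀ z z', Elem s i z → Elem s' i z' → z = z') inferInstance
    (fun hi z z' hz hz' => by
      rw [hz.unique (hs c hi), hz'.unique (hs' c hi), h.1, h'.1])
    (fun i hi ih hi' z z' hz hz' => by
      have hi1 := (lt_iff_add_one_le _ _).1 hi
      rw [hz.unique (hs i hi'), hz'.unique (hs' i hi'), h.2 i hi, h'.2 i hi,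
        ih hi1 _ _ (hs _ hi1) (hs' _ hi1)])
  exact fun i hi => key i hi hi _ _ (hs i hi) (hs' i hi)

/-- Being a sentence is arithmetical, so this induction runs inside `M` and reaches nonstandard
indices too. -/
theorem StoppingRec.isSent {c : M} {α β d : M → M} (hd : CodedSeq c d)
    (h : StoppingRec c α β d) (hα : ∀ i ≤ c, IsSent (α i)) (hβ : ∀ i ≤ c, IsSent (β i)) :
    ∀ i ≤ c, IsSent (d i) := by
  obtain ⟨s, hs⟩ := hd
  have key := backward_induction (c := c)
    (P := fun i => i ≤ c → ∀ z, Elem s i z → IsSent z) inferInstance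
    (fun hi z hz => by
      rw [hz.unique (hs c hi), h.1]
      exact (hα c hi).and (hβ c hi))
    (fun i hi ih hi' z hz => by
      have hi1 := (lt_iff_add_one_le _ _).1 hi
      rw [hz.unique (hs i hi'), h.2 i hi]
      exact (hα i hi').stoppingStep (hβ i hi') (ih hi1 _ (hs _ hi1)))
  exact fun i hi => key i hi hi _ (hs i hi)

end StoppingDisj

end PA

/-! ### The main theorem -/

theorem mainTheorem1 {M : Type u} [LPA.Structure M] (T : Set M) (hT : PA.IsCTMinus M T)
    (c : M) (α β : M → M)
    (hα : PA.CodedSeq c α) (hαs : ∀ i, PA.le i c → PA.IsSent (α i))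
    (hβ : PA.CodedSeq c β) (hβs : ∀ i, PA.le i c → PA.IsSent (β i))
    (k₀ : M) (hk₀c : PA.le k₀ c) (hk₀ : α k₀ ∈ T) (hmin : ∀ i, PA.lt i k₀ → α i ∉ T)
    (hstd : PA.IsStandard k₀) :
    (∀ a, PA.le a c → ∃! δ, PA.IsStoppingDisj c α β a δ) ∧
      ∀ δ, PA.IsStoppingDisj c α β PA.zero δ → (δ ∈ T ↔ β k₀ ∈ T) := by
  have hM : PA.PAModel M := ⟨hT.pa⟩
  simp only [PA.le_iff, PA.lt_iff] at hαs hβs hk₀c hmin ⊢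
  refine ⟨fun a ha => ?_, fun δ hδ => ?_⟩
  · obtain ⟨d, hd, hrec⟩ := PA.exists_stoppingRec hα hβ
    refine ⟨d a, PA.isStoppingDisj_iff.2 ⟨d, hd, hrec, rfl⟩, fun δ hδ => ?_⟩
    obtain ⟨d', hd', hrec', rfl⟩ := PA.isStoppingDisj_iff.1 hδ
    exact hrec'.unique hd' hd hrec a ha
  · obtain ⟨d, hd, hrec, rfl⟩ := PA.isStoppingDisj_iff.1 hδ
    have hds := hrec.isSent hd hαs hβs
    obtain ⟨n, rfl⟩ := hstd
    rw [PA.std_eq] at *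
    -- The last index `c` has its own clause, but since `α n` is true both clauses reduce to `β n`.
    have h_at : d n ∈ T ↔ β n ∈ T := by
      rcases hk₀c.lt_or_eq with hlt | rfl
      · rw [hrec.2 _ hlt, hT.stoppingStep_iff (hαs _ hlt.le) (hβs _ hlt.le)
          (hds _ ((PA.lt_iff_add_one_le _ _).1 hlt))]
        tauto
      · rw [hrec.1, hT.and_iff (hαs _ le_rfl) (hβs _ le_rfl)]
        tauto
    have h_before : ∀ j ≤ n, d PA.zero ∈ T ↔ d (j : M) ∈ T := by
      intro j hj
      -- Standardness of `k₀` enters here: the induction is on natural numbers outside `M`, so it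
      -- may mention `T`. Minimality makes each `α j` false, which moves the truth value on to `j +
      -- 1`.
      induction j with
      | zero => rw [Nat.cast_zero, PA.zero_eq]
      | succ j ih =>
        have hjn : (j : M) < n := Nat.cast_lt.2 hj
        have hjc : (j : M) < c := hjn.trans_le hk₀c
        have hnot := hmin _ hjn
        rw [ih (Nat.le_of_succ_le hj), hrec.2 _ hjc, hT.stoppingStep_iff (hαs _ hjc.le)
          (hβs _ hjc.le) (hds _ ((PA.lt_iff_add_one_le _ _).1 hjc)), Nat.cast_succ]
        tauto
    exact (h_before n le_rfl).trans h_at
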